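/- Theorem (Non-Monotone Submodular). Let $X$ be a finite ground set in which each element $e$ is active independently with probability $p_e\in[0,1]$, let $f:2^X\to\mathbb{R}_{\ge 0}$ be a non-negative (possibly non-monotone) submodular function, i.e. $f(A\cup B)+f(A\cap B)\le f(A)+f(B)$ for all $A,B\subseteq X$, and let $\mathcal{C}$ be a prefix-closed family of finite sequences of elements of $X$ (every prefix of a sequence in $\mathcal{C}$ is in $\mathcal{C}$). Put $f^{\max}(S)=\max_{T\subseteq S}f(T)$. An adaptive strategy is a finite binary tree $\mathcal{T}$ whose internal nodes are labelled by elements of $X$ and have a yes-arc, followed if the probed element is active, and a no-arc, followed otherwise, such that on every root-leaf path no element is probed twice and the sequence of probed elements belongs to $\mathcal{C}$. Its value is $\mathsf{adap}(\mathcal{T},f)=\mathbb{E}_\ell[f^{\max}(A_\ell)]$, where the random leaf $\ell$ is reached by following the yes-arc at a node labelled $e$ with probability $p_e$ and the no-arc with probability $1-p_e$, and $A_\ell$ is the set of elements whose yes-arc was taken. A non-adaptive strategy is a sequence $\sigma\in\mathcal{C}$ without repetitions; its value is $\mathbb{E}_{R}[f^{\max}(R\cap\sigma)]$, where $R\subseteq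 X$ contains each $e$ independently with probability $p_e$. Then the adaptivity gap, i.e. the ratio between the largest value of an adaptive strategy and the largest value of a non-adaptive strategy, is at most $40$ (that is, the former is at most $40$ times the latter). -/

import Mathlib

namespace StochasticProbing

/-- `f(A ∪ B) + f(A ∩ B) ≤ f(A) + f(B)` for all `A, B ⊆ X`. -/
def IsSubmodular {X : Type*} [DecidableEq X] (f : Finset X → ℝ) : Prop :=
  ∀ A B : Finset X, f (A ∪ B) + f (A ∩ B) ≤ f A + f B

/-- A probing constraint is a family of (finite) sequences of elements; it is prefix-closed when
every prefix of a member is a member. -/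
def IsPrefixClosed {X : Type*} (C : Set (List X)) : Prop :=
  ∀ s t : List X, s <+: t → t ∈ C → s ∈ C

/-- A sequence of elements may be probed if it has no repetition and satisfies the constraint. -/
def FeasibleSeq {X : Type*} (C : Set (List X)) (s : List X) : Prop :=
  s.Nodup ∧ s ∈ C

/-- `f^max(S)`, the maximum of `f(T)` over `T ⊆ S`. -/
noncomputable def fmax {X : Type*} (f : Finset X → ℝ) (S : Finset X) : ℝ :=
  S.powerset.sup' S.powerset_nonempty f

/-- Adaptive strategy trees: an internal node probes an element and continues in the first
subtree if it is active (`yes` arc), in the second one if it is not (`no` arc). -/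
inductive StrategyTree (X : Type*) where
  | leaf : StrategyTree X
  | node (elt : X) (yes no : StrategyTree X) : StrategyTree X

namespace StrategyTree

/-- The root-leaf paths, one for each leaf. A path is the list of the probed elements, each with
the arc that is taken: `true` for `yes`, `false` for `no`. -/
def paths {X : Type*} : StrategyTree X → List (List (X × Bool))
  | leaf => [[]]
  | node e y n => (y.paths.map fun P => (e, true) :: P) ++ (n.paths.map fun P => (e, false) :: P)

end StrategyTree

/-- The sequence of the elements probed on a path. -/
def probed {X : Type*} (P : List (X × Bool)) : List X :=
  P.map Prod.fst

/-- The set `A_ℓ` of the active elements on a path. -/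
def active {X : Type*} [DecidableEq X] (P : List (X × Bool)) : Finset X :=
  ((P.filter fun a => a.2).map Prod.fst).toFinset

/-- The probability of following a path: the product of `p_e` over its `yes` arcs and of `1 - p_e`
over its `no` arcs. -/
noncomputable def pathProb {X : Type*} (p : X → ℝ) (P : List (X × Bool)) : ℝ :=
  (P.map fun a => if a.2 then p a.1 else 1 - p a.1).prod

/-- A tree is feasible if along each root-leaf path no element is probed twice and the sequence
of the probed elements satisfies the constraint. -/
def StrategyTree.Feasible {X : Type*} (C : Set (List X)) (T : StrategyTree X) : Prop :=
  ∀ P ∈ T.paths, FeasibleSeq C (probed P)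

/-- `adap(T, f)`, the expectation of `f^max(A_ℓ)` over a random leaf `ℓ` of `T`. -/
noncomputable def adap {X : Type*} [DecidableEq X] (p : X → ℝ) (f : Finset X → ℝ)
    (T : StrategyTree X) : ℝ :=
  (T.paths.map fun P => pathProb p P * fmax f (active P)).sum

/-- The probability that `R` is the set of all active elements of `X`, elements being active
independently with probabilities `p_e`. -/
noncomputable def setProb {X : Type*} [Fintype X] [DecidableEq X] (p : X → ℝ)
    (R : Finset X) : ℝ :=
  (∏ e ∈ R, p e) * ∏ e ∈ Rᶜ, (1 - p e)

/-- The expected value of the non-adaptive strategy that probes the sequence `s`: the expectation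
of `f^max(R ∩ s)` over the random set `R` of active elements. -/
noncomputable def nonadap {X : Type*} [Fintype X] [DecidableEq X] (p : X → ℝ)
    (f : Finset X → ℝ) (s : List X) : ℝ :=
  ∑ R : Finset X, setProb p R * fmax f (R ∩ s.toFinset)

/-- The value of the best adaptive strategy (values are non-negative when `f` is). -/
noncomputable def adaptiveOpt {X : Type*} [DecidableEq X] (p : X → ℝ) (f : Finset X → ℝ)
    (C : Set (List X)) : ENNReal :=
  ⨆ (T : StrategyTree X) (_ : T.Feasible C), ENNReal.ofReal (adap p f T)

/-- The value of the best non-adaptive strategy (values are non-negative when `f` is). -/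
noncomputable def nonadaptiveOpt {X : Type*} [Fintype X] [DecidableEq X] (p : X → ℝ)
    (f : Finset X → ℝ) (C : Set (List X)) : ENNReal :=
  ⨆ (s : List X) (_ : FeasibleSeq C s), ENNReal.ofReal (nonadap p f s)

/-- The ratio of the two optimal values, in `[0, ∞]`. It is `∞` when only the non-adaptive value
vanishes, and `0 / 0` counts as `0`; thus it is at most a real number `c > 0` exactly when the
adaptive value is at most `c` times the non-adaptive one. -/
noncomputable def adaptivityGap {X : Type*} [Fintype X] [DecidableEq X] (p : X → ℝ)
    (f : Finset X → ℝ) (C : Set (List X)) : ENNReal :=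
  adaptiveOpt p f C / nonadaptiveOpt p f C

end StochasticProbing

namespace StochasticProbing

/-! The non-adaptive strategy follows a random path of the tree in advance and probes its elements
afresh. Two random subsets of the path link the two values. The fresh sample keeps each `e` with
probability `p e / 4`, whatever its outcome; the mixed sample adds an extra chance `1 / 4` when `e`
was active (`unionProb`). For every set `T` of active elements the mixed sample has mean at least `f
T / 8`: `exists_le_sampleMean` bounds it below by a mixture giving `T` weight `1 / 8`, and
non-negativity discards the rest. Averaged over paths, the mixed sample is worth at most twice the
fresh one (`treeMean_union_le`), because the extra chance at a node also averages to `p e / 4`. On a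
fixed path, the fresh sample is worth at most the non-adaptive value, since `fmax f` is a monotone
majorant of `f`. Hence some path achieves the factor 8 · 2 = 16. -/

theorem convex_combination_le {x a b a' b' : ℝ} (hx0 : 0 ≤ x) (hx1 : x ≤ 1) (ha : a ≤ a')
    (hb : b ≤ b') : (1 - x) * a + x * b ≤ (1 - x) * a' + x * b' :=
  add_le_add (mul_le_mul_of_nonneg_left ha (sub_nonneg.2 hx1)) (mul_le_mul_of_nonneg_left hb hx0)

/-! ### Elementary facts on `fmax` and on paths. -/

section Basic

variable {X : Type*}

theorem le_fmax (f : Finset X → ℝ) (S : Finset X) : f S ≤ fmax f S :=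
  Finset.le_sup' f (Finset.mem_powerset_self S)

theorem monotone_fmax (f : Finset X → ℝ) : Monotone (fmax f) := fun _ _ h =>
  Finset.sup'_mono f (Finset.powerset_mono.2 h) _

theorem mem_paths_yes {e : X} {y n : StrategyTree X} {P : List (X × Bool)} (hP : P ∈ y.paths) :
    (e, true) :: P ∈ (StrategyTree.node e y n).paths := by
  simp [StrategyTree.paths, hP]

theorem mem_paths_no {e : X} {y n : StrategyTree X} {P : List (X × Bool)} (hP : P ∈ n.paths) :
    (e, false) :: P ∈ (StrategyTree.node e y n).paths := by
  simp [StrategyTree.paths, hP]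

theorem paths_ne_nil (T : StrategyTree X) : T.paths ≠ [] := by
  induction T with
  | leaf => simp [StrategyTree.paths]
  | node e y n ihy _ => simp [StrategyTree.paths, ihy]

theorem pathProb_nonneg {p : X → ℝ} (hp0 : ∀ e, 0 ≤ p e) (hp1 : ∀ e, p e ≤ 1)
    (P : List (X × Bool)) : 0 ≤ pathProb p P := by
  refine List.prod_nonneg fun x hx => ?_
  obtain ⟨a, -, rfl⟩ := List.mem_map.1 hx
  split
  · exact hp0 _
  · exact sub_nonneg.2 (hp1 _)

end Basic

/-! ### Submodular functions at independent random sets. -/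

section Sampling

variable {X : Type*} [DecidableEq X]

/-- The expectation of `f` at a random set to which each entry `(e, x)` of the list contributes
the element `e` independently with probability `x`. -/
noncomputable def sampleMean : List (X × ℝ) → (Finset X → ℝ) → ℝ
  | [], f => f ∅
  | a :: L, f => (1 - a.2) * sampleMean L f + a.2 * sampleMean L fun S => f (insert a.1 S)

theorem sampleMean_linear (L : List (X × ℝ)) (f g : Finset X → ℝ) (c d : ℝ) :
    sampleMean L (fun S => c * f S + d * g S) = c * sampleMean L f + d * sampleMean L g := by
  induction L generalizing f g with
  | nil => rfl
  | cons a L ih =>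
    simp only [sampleMean]
    rw [ih f g, ih (fun S => f (insert a.1 S)) (fun S => g (insert a.1 S))]
    ring

theorem IsSubmodular.comp_insert {f : Finset X → ℝ} (hf : IsSubmodular f) (e : X) :
    IsSubmodular fun S => f (insert e S) := by
  intro A B
  have h := hf (insert e A) (insert e B)
  rwa [← Finset.insert_union_distrib, ← Finset.insert_inter_distrib] at h

theorem IsSubmodular.linear {f g : Finset X → ℝ} (hf : IsSubmodular f) (hg : IsSubmodular g)
    {c d : ℝ} (hc : 0 ≤ c) (hd : 0 ≤ d) : IsSubmodular fun S => c * f S + d * g S := by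
  intro A B
  have h₁ := mul_le_mul_of_nonneg_left (hf A B) hc
  have h₂ := mul_le_mul_of_nonneg_left (hg A B) hd
  simp only
  linarith

/-- Marginal values decrease. -/
theorem IsSubmodular.insert_add_le {f : Finset X → ℝ} (hf : IsSubmodular f) {e : X}
    {A B : Finset X} (hAB : A ⊆ B) (he : e ∉ B) :
    f (insert e B) + f A ≤ f (insert e A) + f B := by
  have h := hf (insert e A) B
  rwa [Finset.insert_union, Finset.union_eq_right.2 hAB, Finset.insert_inter_of_notMem he,
    Finset.inter_eq_left.2 hAB] at h

/-- A random set that contains the elements of `T` with probability at least `1 / 4` and the other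
ones with probability at most `1 / 2` has at least the mean value of the union of a subset of `T`,
replaced by `T` with probability `1 / 4`, and a subset of the complement of `T`, kept with
probability `1 / 2`. -/
theorem exists_le_sampleMean (L : List (X × ℝ)) (hL : (L.map Prod.fst).Nodup)
    {f : Finset X → ℝ} (hf : IsSubmodular f) (T : Finset X)
    (hT : ∀ e ∈ T, e ∈ L.map Prod.fst)
    (hx : ∀ a ∈ L, (a.1 ∈ T → 1 / 4 ≤ a.2 ∧ a.2 ≤ 1) ∧ (a.1 ∉ T → 0 ≤ a.2 ∧ a.2 ≤ 1 / 2)) :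
    ∃ W V : Finset X, W ⊆ T ∧ (∀ e ∈ V, e ∈ L.map Prod.fst ∧ e ∉ T) ∧
      1 / 8 * f T + 1 / 8 * f (T ∪ V) + 3 / 8 * f W + 3 / 8 * f (W ∪ V) ≤ sampleMean L f := by
  induction L generalizing f T with
  | nil =>
    have hT0 : T = ∅ := Finset.eq_empty_of_forall_notMem fun e he => by simpa using hT e he
    refine ⟨∅, ∅, by simp, by simp, ?_⟩
    simp only [hT0, sampleMean, Finset.union_empty]
    linarith
  | cons a L ih =>
    obtain ⟨e, x⟩ := a
    simp only [List.map_cons, List.nodup_cons] at hL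
    obtain ⟨heL, hLn⟩ := hL
    have hx' := hx (e, x) (by simp)
    simp only at hx' heL
    by_cases heT : e ∈ T
    · obtain ⟨hx4, hx1⟩ := hx'.1 heT
      have hmem : ∀ i ∈ L, (i.1 ∈ T.erase e ↔ i.1 ∈ T) := by
        intro i hi
        have : i.1 ≠ e := by
          rintro rfl
          exact heL (List.mem_map_of_mem hi)
        simp [this]
      have hT' : ∀ i ∈ T.erase e, i ∈ L.map Prod.fst := by
        intro i hi
        have h := hT i (Finset.mem_of_mem_erase hi)
        rw [List.map_cons, List.mem_cons] at h
        exact h.resolve_left (Finset.ne_of_mem_erase hi)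
      have hxL : ∀ i ∈ L, (i.1 ∈ T.erase e → 1 / 4 ≤ i.2 ∧ i.2 ≤ 1) ∧
          (i.1 ∉ T.erase e → 0 ≤ i.2 ∧ i.2 ≤ 1 / 2) := by
        intro i hi
        rw [hmem i hi]
        exact hx i (List.mem_cons_of_mem _ hi)
      have hins : insert e (T.erase e) = T := Finset.insert_erase heT
      have hV' : ∀ V : Finset X, (∀ i ∈ V, i ∈ L.map Prod.fst ∧ i ∉ T.erase e) →
          ∀ i ∈ V, i ∈ ((e, x) :: L).map Prod.fst ∧ i ∉ T := by
        intro V hV i hi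
        obtain ⟨h₁, h₂⟩ := hV i hi
        refine ⟨by rw [List.map_cons]; exact List.mem_cons_of_mem _ h₁, fun h => h₂ ?_⟩
        exact Finset.mem_erase.2 ⟨fun h' => heL (h' ▸ h₁), h⟩
      -- The mean is affine in `x`. It is at least `M₁` if `M₁ ≤ M₀`, and otherwise at least `3/4 M₀
      -- + 1/4 M₁` because `1/4 ≤ x`; the induction hypothesis is applied to both functions. In the
      -- mixture, replacing `T.erase e` by `T` costs `1/8 · 3/4` of a marginal, paid for by `3/8 ·
      -- 1/4` of the larger marginal at `W₂`; likewise with `V₂` added.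
      obtain ⟨W₁, V₁, hW₁, hV₁, h₁⟩ := ih hLn (hf.comp_insert e) (T.erase e) hT' hxL
      obtain ⟨W₂, V₂, hW₂, hV₂, h₂⟩ := ih hLn
        (hf.linear (hf.comp_insert e) (c := 3 / 4) (d := 1 / 4) (by norm_num) (by norm_num))
        (T.erase e) hT' hxL
      rw [sampleMean_linear] at h₂
      simp only [← Finset.insert_union, hins] at h₁ h₂
      have hs₁ := hf.insert_add_le hW₂ (Finset.notMem_erase e T)
      have hs₂ := hf.insert_add_le (e := e) (Finset.union_subset_union_left (t := V₂) hW₂) (by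
        rw [Finset.mem_union, not_or]
        exact ⟨Finset.notMem_erase e T, fun h => heL (hV₂ e h).1⟩)
      rw [← Finset.insert_union, hins, ← Finset.insert_union] at hs₂
      rw [hins] at hs₁
      simp only [sampleMean]
      set M₀ := sampleMean L f
      set M₁ := sampleMean L fun S => f (insert e S)
      rcases le_total M₀ M₁ with h | h
      · refine ⟨W₂, V₂, hW₂.trans (Finset.erase_subset _ _), hV' V₂ hV₂, ?_⟩
        nlinarith
      · refine ⟨insert e W₁, V₁, ?_, hV' V₁ hV₁, ?_⟩
        · rw [← hins]
          exact Finset.insert_subset_insert e hW₁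
        · nlinarith
    · obtain ⟨hx0, hx2⟩ := hx'.2 heT
      have hT' : ∀ i ∈ T, i ∈ L.map Prod.fst := by
        intro i hi
        have h := hT i hi
        rw [List.map_cons, List.mem_cons] at h
        exact h.resolve_left fun h' : i = e => heT (h' ▸ hi)
      have hxL := fun i hi => hx i (List.mem_cons_of_mem (e, x) hi)
      -- Here `x ≤ 1/2`, so the mean is at least `M₀` or at least the equal mixture. In the latter
      -- case `e` joins `V₂`: its marginals at `T` and `W₂` dominate those at `T ∪ V₂` and `W₂ ∪
      -- V₂`.
      obtain ⟨W₁, V₁, hW₁, hV₁, h₁⟩ := ih hLn hf T hT' hxL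
      obtain ⟨W₂, V₂, hW₂, hV₂, h₂⟩ := ih hLn
        (hf.linear (hf.comp_insert e) (c := 1 / 2) (d := 1 / 2) (by norm_num) (by norm_num))
        T hT' hxL
      rw [sampleMean_linear] at h₂
      have heV : e ∉ V₂ := fun h => heL (hV₂ e h).1
      have hs₁ := hf.insert_add_le (e := e) (Finset.subset_union_left (s₁ := T) (s₂ := V₂))
        (by simp [heT, heV])
      have hs₂ := hf.insert_add_le (e := e) (Finset.subset_union_left (s₁ := W₂) (s₂ := V₂))
        (by simpa [heV] using fun h => heT (hW₂ h))
      simp only [sampleMean]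
      set M₀ := sampleMean L f
      set M₁ := sampleMean L fun S => f (insert e S)
      rcases le_total M₀ M₁ with h | h
      · refine ⟨W₁, V₁, hW₁, fun i hi => ⟨?_, (hV₁ i hi).2⟩, ?_⟩
        · rw [List.map_cons]
          exact List.mem_cons_of_mem _ (hV₁ i hi).1
        · nlinarith
      · refine ⟨W₂, insert e V₂, hW₂, fun i hi => ?_, ?_⟩
        · rcases Finset.mem_insert.1 hi with rfl | hi
          · exact ⟨by simp, heT⟩
          · rw [List.map_cons]
            exact ⟨List.mem_cons_of_mem _ (hV₂ i hi).1, (hV₂ i hi).2⟩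
        · rw [Finset.union_insert, Finset.union_insert]
          nlinarith

/-- A monotone majorant has at least the mean value when every element is sampled with a larger
probability. -/
theorem sampleMean_le_of_monotone (s : List X) {x y : X → ℝ} (hx : ∀ e, 0 ≤ x e)
    (hxy : ∀ e, x e ≤ y e) (hy : ∀ e, y e ≤ 1) {f g : Finset X → ℝ} (hg : Monotone g)
    (hfg : ∀ S, f S ≤ g S) :
    sampleMean (s.map fun e => (e, x e)) f ≤ sampleMean (s.map fun e => (e, y e)) g := by
  induction s generalizing f g with
  | nil => exact hfg ∅
  | cons e s ih =>
    simp only [List.map_cons, sampleMean]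
    have hge : Monotone fun S => g (insert e S) :=
      fun A B h => hg (Finset.insert_subset_insert e h)
    have h₁ := ih hg hfg
    have h₂ := ih hge (fun S => (hfg S).trans (hg (Finset.subset_insert e S)))
    have h₃ := ih hge (fun S => hfg (insert e S))
    -- Coupling of the two samples: `e` lies in neither, only in the larger one, or in both.
    have m₁ := mul_le_mul_of_nonneg_left h₁ (sub_nonneg.2 (hy e))
    have m₂ := mul_le_mul_of_nonneg_left h₂ (sub_nonneg.2 (hxy e))
    have m₃ := mul_le_mul_of_nonneg_left h₃ (hx e)
    linarith

end Sampling

/-! ### The non-adaptive value as a sample mean. -/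

section NonAdaptive

variable {X : Type*} [Fintype X] [DecidableEq X]

theorem sum_setProb (p : X → ℝ) : ∑ R : Finset X, setProb p R = 1 := by
  have h := Finset.prod_add p (fun e => 1 - p e) Finset.univ
  simp only [add_sub_cancel, Finset.prod_const_one, Finset.powerset_univ] at h
  rw [h]
  exact Finset.sum_congr rfl fun R _ => by rw [setProb, Finset.compl_eq_univ_sdiff]

/-- Conditioning on whether `e` is active pairs each `R` avoiding `e` with `insert e R`. -/
theorem sum_setProb_mul (p : X → ℝ) (e : X) (G : Finset X → ℝ) :
    ∑ R : Finset X, setProb p R * G R = ∑ R ∈ (Finset.univ.erase e).powerset,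
      ((∏ i ∈ R, p i) * ∏ i ∈ (Finset.univ.erase e) \ R, (1 - p i)) *
        ((1 - p e) * G R + p e * G (insert e R)) := by
  have hu : (Finset.univ : Finset (Finset X)) = (insert e (Finset.univ.erase e)).powerset := by
    rw [Finset.insert_erase (Finset.mem_univ e), Finset.powerset_univ]
  rw [hu, Finset.sum_powerset_insert (Finset.notMem_erase e _), ← Finset.sum_add_distrib]
  refine Finset.sum_congr rfl fun R hR => ?_
  have heR : e ∉ R := fun h => Finset.notMem_erase e _ (Finset.mem_powerset.1 hR h)
  have h₁ : Rᶜ = insert e (Finset.univ.erase e \ R) := by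
    ext i
    by_cases h : i = e <;> simp [h, heR]
  have h₂ : (insert e R)ᶜ = Finset.univ.erase e \ R := by
    ext i
    by_cases h : i = e <;> simp [h]
  rw [setProb, setProb, h₂, h₁, Finset.prod_insert (by simp), Finset.prod_insert heR]
  ring

theorem sum_setProb_mul_inter (p : X → ℝ) (G : Finset X → ℝ) (s : List X) (hs : s.Nodup) :
    ∑ R : Finset X, setProb p R * G (R ∩ s.toFinset) =
      sampleMean (s.map fun e => (e, p e)) G := by
  induction s generalizing G with
  | nil => simp [sampleMean, ← Finset.sum_mul, sum_setProb]
  | cons e s ih =>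
    obtain ⟨hes, hs⟩ := List.nodup_cons.1 hs
    simp only [List.map_cons, sampleMean]
    rw [← ih G hs, ← ih _ hs, sum_setProb_mul p e, sum_setProb_mul p e, sum_setProb_mul p e,
      Finset.mul_sum, Finset.mul_sum, ← Finset.sum_add_distrib]
    refine Finset.sum_congr rfl fun R hR => ?_
    have heR : e ∉ R := fun h => Finset.notMem_erase e _ (Finset.mem_powerset.1 hR h)
    have hes' : e ∉ s.toFinset := by simpa using hes
    rw [List.toFinset_cons, Finset.inter_insert_of_notMem heR, ← Finset.insert_inter_distrib,
      Finset.insert_inter_of_notMem hes']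
    ring

theorem sampleMean_le_nonadap {p : X → ℝ} (hp0 : ∀ e, 0 ≤ p e) (hp1 : ∀ e, p e ≤ 1)
    (f : Finset X → ℝ) {s : List X} (hs : s.Nodup) :
    sampleMean (s.map fun e => (e, p e / 4)) f ≤ nonadap p f s := by
  rw [nonadap, sum_setProb_mul_inter p (fmax f) s hs]
  exact sampleMean_le_of_monotone s (fun e => by linarith [hp0 e]) (fun e => by linarith [hp0 e])
    hp1 (monotone_fmax f) (le_fmax f)

end NonAdaptive

/-! ### Sampling along a random path of the tree. -/

section Tree

variable {X : Type*} [DecidableEq X]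

/-- The mean of `f` when a random path is followed and then each element `e` probed on it, with
outcome `b`, is sampled with probability `v e b`. -/
noncomputable def treeMean (p : X → ℝ) (v : X → Bool → ℝ) (T : StrategyTree X)
    (f : Finset X → ℝ) : ℝ :=
  (T.paths.map fun P => pathProb p P * sampleMean (P.map fun a => (a.1, v a.1 a.2)) f).sum

theorem treeMean_leaf (p : X → ℝ) (v : X → Bool → ℝ) (f : Finset X → ℝ) :
    treeMean p v .leaf f = f ∅ := by
  simp [treeMean, StrategyTree.paths, pathProb, sampleMean]

theorem treeMean_node (p : X → ℝ) (v : X → Bool → ℝ) (e : X) (y n : StrategyTree X)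
    (f : Finset X → ℝ) :
    treeMean p v (.node e y n) f =
      (1 - p e) * ((1 - v e false) * treeMean p v n f +
        v e false * treeMean p v n fun S => f (insert e S)) +
      p e * ((1 - v e true) * treeMean p v y f +
        v e true * treeMean p v y fun S => f (insert e S)) := by
  simp only [treeMean, StrategyTree.paths, List.map_append, List.map_map, List.sum_append,
    ← List.sum_map_mul_left, ← List.sum_map_add]
  rw [add_comm]
  congr 3 <;>
  · funext P
    simp [pathProb, sampleMean]
    ring

theorem sum_pathProb (p : X → ℝ) (T : StrategyTree X) : (T.paths.map (pathProb p)).sum = 1 := by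
  -- Sampling nothing from the constant function 1 leaves the total path probability.
  have h : ∀ T : StrategyTree X, treeMean p (fun _ _ => 0) T (fun _ => 1) = 1 := by
    intro T
    induction T with
    | leaf => simp [treeMean_leaf]
    | node e y n ihy ihn => simp [treeMean_node, ihy, ihn]
  have hs : ∀ L : List (X × ℝ), sampleMean L (fun _ => 1) = 1 := by
    intro L
    induction L with
    | nil => rfl
    | cons a L ih => simp [sampleMean, ih]
  have := h T
  simpa [treeMean, hs] using this

/-- The sampled set never contains `e`, so the marginal of `e` there is at most its marginal at `∅`.
-/
theorem treeMean_insert_add_le {p : X → ℝ} (hp0 : ∀ e, 0 ≤ p e) (hp1 : ∀ e, p e ≤ 1)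
    {v : X → Bool → ℝ} (hv0 : ∀ e b, 0 ≤ v e b) (hv1 : ∀ e b, v e b ≤ 1)
    (T : StrategyTree X) {f : Finset X → ℝ} (hf : IsSubmodular f) {e : X}
    (he : ∀ P ∈ T.paths, e ∉ probed P) :
    treeMean p v T (fun S => f (insert e S)) + f ∅ ≤ treeMean p v T f + f {e} := by
  induction T generalizing f with
  | leaf => simp [treeMean_leaf, add_comm]
  | node a y n ihy ihn =>
    have hy : ∀ P ∈ y.paths, e ∉ probed P := fun P hP h =>
      he _ (mem_paths_yes hP) (List.mem_cons_of_mem _ h)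
    have hn : ∀ P ∈ n.paths, e ∉ probed P := fun P hP h =>
      he _ (mem_paths_no hP) (List.mem_cons_of_mem _ h)
    have hea : e ≠ a := by
      obtain ⟨P, hP⟩ := List.exists_mem_of_ne_nil _ (paths_ne_nil y)
      rintro rfl
      exact he _ (mem_paths_yes hP) (by simp [probed])
    have hs := hf.insert_add_le (e := e) (Finset.empty_subset {a}) (by simpa using hea)
    have hc : ∀ S, insert e (insert a S) = insert a (insert e S) :=
      fun S => Finset.insert_comm e a S
    -- The bound `f {e} - f ∅` is the same for both arcs, so it survives averaging over the outcome
    -- at `a`.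
    have step : ∀ t : StrategyTree X,
        (∀ {f : Finset X → ℝ}, IsSubmodular f →
          treeMean p v t (fun S => f (insert e S)) + f ∅ ≤ treeMean p v t f + f {e}) →
        ∀ x : ℝ, 0 ≤ x → x ≤ 1 →
          (1 - x) * treeMean p v t (fun S => f (insert e S)) +
            x * treeMean p v t (fun S => f (insert e (insert a S))) ≤
          (1 - x) * treeMean p v t f + x * treeMean p v t (fun S => f (insert a S)) +
            (f {e} - f ∅) := by
      intro t ht x hx0 hx1
      have h₁ := ht hf
      have h₂ := ht (hf.comp_insert a)
      simp only [hc]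
      simp only [insert_empty_eq] at h₂ hs
      rw [Finset.pair_comm] at hs
      have := convex_combination_le hx0 hx1 (le_sub_iff_add_le.2 h₁)
        (b := treeMean p v t fun S => f (insert a (insert e S)))
        (b' := treeMean p v t (fun S => f (insert a S)) + (f {e} - f ∅)) (by linarith)
      linarith
    have h := convex_combination_le (hp0 a) (hp1 a)
      (step n (fun hf => ihn hf hn) (v a false) (hv0 _ _) (hv1 _ _))
      (step y (fun hf => ihy hf hy) (v a true) (hv0 _ _) (hv1 _ _))
    rw [treeMean_node, treeMean_node]
    linarith

/-- The sampling probabilities for the union of a sample of the active elements of the path and a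
disjoint sample of newly activated ones. -/
noncomputable def unionProb (p : X → ℝ) (e : X) (b : Bool) : ℝ :=
  if b then 1 / 4 + p e / 4 else p e / 4

/-- The term `f ∅` strengthens the induction: for `f (insert e ·)` it becomes `f {e}`, which makes
the errors at a node cancel. -/
theorem treeMean_union_le {p : X → ℝ} (hp0 : ∀ e, 0 ≤ p e) (hp1 : ∀ e, p e ≤ 1)
    (T : StrategyTree X) (hT : ∀ P ∈ T.paths, (probed P).Nodup) {f : Finset X → ℝ}
    (hf : IsSubmodular f) :
    treeMean p (unionProb p) T f + f ∅ ≤ 2 * treeMean p (fun e _ => p e / 4) T f := by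
  induction T generalizing f with
  | leaf =>
    simp only [treeMean_leaf]
    linarith
  | node e y n ihy ihn =>
    have hy : ∀ P ∈ y.paths, e ∉ probed P ∧ (probed P).Nodup := fun P hP =>
      List.nodup_cons.1 (hT _ (mem_paths_yes hP))
    have hn : ∀ P ∈ n.paths, e ∉ probed P ∧ (probed P).Nodup := fun P hP =>
      List.nodup_cons.1 (hT _ (mem_paths_no hP))
    have y₀ := ihy (fun P hP => (hy P hP).2) hf
    have y₁ := ihy (fun P hP => (hy P hP).2) (hf.comp_insert e)
    have n₀ := ihn (fun P hP => (hn P hP).2) hf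
    have n₁ := ihn (fun P hP => (hn P hP).2) (hf.comp_insert e)
    have hm := treeMean_insert_add_le hp0 hp1 (v := fun e _ => p e / 4)
      (fun e _ => by linarith [hp0 e]) (fun e _ => by linarith [hp1 e]) y hf
      (fun P hP => (hy P hP).1)
    simp only [insert_empty_eq] at y₁ n₁
    simp only [treeMean_node, unionProb, if_true, Bool.false_eq_true, if_false]
    set U₀ := treeMean p (unionProb p) y f
    set U₁ := treeMean p (unionProb p) y fun S => f (insert e S)
    set B₀ := treeMean p (fun e _ => p e / 4) y f
    set B₁ := treeMean p (fun e _ => p e / 4) y fun S => f (insert e S)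
    have q0 := hp0 e
    have q1 := hp1 e
    have hN := convex_combination_le (x := p e / 4) (by linarith) (by linarith) n₀ n₁
    have hA : U₁ + 2 * f ∅ - f {e} ≤ 2 * B₀ := by linarith
    have c₀ := mul_le_mul_of_nonneg_left y₀ (show 0 ≤ 3 / 4 - p e / 4 by linarith)
    have c₁ := mul_le_mul_of_nonneg_left y₁ (show 0 ≤ p e / 4 by linarith)
    -- The weight `1/4 + p e / 4` of `U₁` is split: `p e / 4` is charged to `B₁` by `c₁`, and the
    -- extra `1/4` to `B₀` by `hA`.
    have hY : (1 - (1 / 4 + p e / 4)) * U₀ + (1 / 4 + p e / 4) * U₁ + f ∅ +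
        (1 - p e) / 4 * (f ∅ - f {e}) ≤ 2 * ((1 - p e / 4) * B₀ + p e / 4 * B₁) := by
      linarith
    -- Weighted by the arc probabilities, the terms `p e * (1 - p e) / 4 * (f {e} - f ∅)` of the two
    -- arcs cancel.
    have hN' := mul_le_mul_of_nonneg_left hN (sub_nonneg.2 q1)
    have hY' := mul_le_mul_of_nonneg_left hY q0
    linarith

theorem fmax_active_le_sampleMean {p : X → ℝ} (hp0 : ∀ e, 0 ≤ p e) (hp1 : ∀ e, p e ≤ 1)
    {f : Finset X → ℝ} (hf0 : ∀ S, 0 ≤ f S) (hf : IsSubmodular f) {P : List (X × Bool)}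
    (hP : (probed P).Nodup) :
    fmax f (active P) ≤ 8 * sampleMean (P.map fun a => (a.1, unionProb p a.1 a.2)) f := by
  refine Finset.sup'_le _ _ fun T hT => ?_
  rw [Finset.mem_powerset] at hT
  have hmap : (P.map fun a => (a.1, unionProb p a.1 a.2)).map Prod.fst = probed P := by
    rw [List.map_map]
    rfl
  have hact : ∀ e ∈ T, (e, true) ∈ P := by
    intro e he
    simpa [active] using hT he
  -- Elements outside `T` may be active too; their probability is still at most `1/4 + 1/4 = 1/2`.
  obtain ⟨W, V, -, -, h⟩ := exists_le_sampleMean (P.map fun a => (a.1, unionProb p a.1 a.2))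
    (by rwa [hmap]) hf T
    (fun e he => by
      rw [hmap]
      exact List.mem_map_of_mem (f := Prod.fst) (hact e he))
    (by
      intro a ha
      obtain ⟨⟨e, b⟩, hb, rfl⟩ := List.mem_map.1 ha
      have h0 := hp0 e
      have h1 := hp1 e
      refine ⟨fun he => ?_, fun _ => ?_⟩
      · have hbt : (e, b) = (e, true) := List.inj_on_of_nodup_map hP hb (hact e he) rfl
        obtain rfl : b = true := (Prod.mk.inj hbt).2
        simp only [unionProb, if_true]
        constructor <;> linarith
      · cases b <;> simp only [unionProb, if_true, Bool.false_eq_true, if_false] <;>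
          constructor <;> linarith)
  linarith [hf0 (T ∪ V), hf0 W, hf0 (W ∪ V)]

theorem adap_le_treeMean {p : X → ℝ} (hp0 : ∀ e, 0 ≤ p e) (hp1 : ∀ e, p e ≤ 1)
    {f : Finset X → ℝ} (hf0 : ∀ S, 0 ≤ f S) (hf : IsSubmodular f) {T : StrategyTree X}
    (hT : ∀ P ∈ T.paths, (probed P).Nodup) :
    adap p f T ≤ 16 * treeMean p (fun e _ => p e / 4) T f := by
  have h₁ : adap p f T ≤ 8 * treeMean p (unionProb p) T f := by
    rw [adap, treeMean, ← List.sum_map_mul_left]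
    refine List.sum_le_sum fun P hP => ?_
    have := mul_le_mul_of_nonneg_left (fmax_active_le_sampleMean hp0 hp1 hf0 hf (hT P hP))
      (pathProb_nonneg hp0 hp1 P)
    linarith
  linarith [treeMean_union_le hp0 hp1 T hT hf, hf0 ∅]

/-- On some path of the tree the non-adaptive strategy is as good as on average. -/
theorem exists_path_adap_le [Fintype X] {p : X → ℝ} (hp0 : ∀ e, 0 ≤ p e) (hp1 : ∀ e, p e ≤ 1)
    {f : Finset X → ℝ} (hf0 : ∀ S, 0 ≤ f S) (hf : IsSubmodular f) {T : StrategyTree X}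
    (hT : ∀ P ∈ T.paths, (probed P).Nodup) :
    ∃ P ∈ T.paths, adap p f T ≤ 16 * nonadap p f (probed P) := by
  obtain ⟨Q, hQ, hmax⟩ := Set.exists_max_image {P | P ∈ T.paths}
    (fun P => nonadap p f (probed P)) (List.finite_toSet _)
    (List.exists_mem_of_ne_nil _ (paths_ne_nil T))
  refine ⟨Q, hQ, (adap_le_treeMean hp0 hp1 hf0 hf hT).trans ?_⟩
  refine mul_le_mul_of_nonneg_left ?_ (by norm_num)
  -- Writing 1 as the sum of the path probabilities reduces the claim to one path at a time.
  rw [← one_mul (nonadap p f (probed Q)), ← sum_pathProb p T, ← List.sum_map_mul_right, treeMean]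
  refine List.sum_le_sum fun P hP => mul_le_mul_of_nonneg_left ?_ (pathProb_nonneg hp0 hp1 P)
  refine le_trans ?_ (hmax P hP)
  have h := sampleMean_le_nonadap hp0 hp1 f (hT P hP)
  rwa [probed, List.map_map] at h

end Tree

end StochasticProbing

theorem mainTheorem2 {X : Type*} [Fintype X] [DecidableEq X]
    (p : X → ℝ) (hp0 : ∀ e, 0 ≤ p e) (hp1 : ∀ e, p e ≤ 1)
    (f : Finset X → ℝ) (hf0 : ∀ S, 0 ≤ f S) (hf : StochasticProbing.IsSubmodular f)
    (C : Set (List X)) (hC : StochasticProbing.IsPrefixClosed C) :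
    StochasticProbing.adaptivityGap p f C ≤ 40 := by
  refine ENNReal.div_le_of_le_mul (iSup₂_le fun T hT => ?_)
  obtain ⟨P, hP, h⟩ := StochasticProbing.exists_path_adap_le hp0 hp1 hf0 hf
    fun P hP => (hT P hP).1
  calc ENNReal.ofReal (StochasticProbing.adap p f T)
      ≤ ENNReal.ofReal (16 * StochasticProbing.nonadap p f (StochasticProbing.probed P)) :=
        ENNReal.ofReal_le_ofReal h
    _ = 16 * ENNReal.ofReal (StochasticProbing.nonadap p f (StochasticProbing.probed P)) := by
        rw [ENNReal.ofReal_mul (by norm_num)]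
        norm_num
    _ ≤ 40 * StochasticProbing.nonadaptiveOpt p f C :=
        mul_le_mul' (by norm_num) (le_iSup₂_of_le (StochasticProbing.probed P) (hT P hP) le_rfl)
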